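/- Let $p$ be a prime, $G$ a finite group, $S\in\mathrm{Syl}_p(G)$ and $M$ a $\mathbb{Z}_{(p)}[G]$-module. Write $P^g=g^{-1}Pg$. The transporter category $\mathcal{T}_S(G)$ has as objects all subgroups of $S$, and $\mathrm{Mor}(P,Q)=\{g\in G\mid P^g\le Q\}$, the composite of $g:P\to Q$ and $h:Q\to R$ being $gh$; thus $\mathrm{Aut}(P)=N_G(P)$. A subgroup $H$ of a finite group $K$ is strongly $p$-embedded if $p$ divides $|H|$, $H\neq K$, and $p\nmid|H\cap H^g|$ for every $g\in K\smallsetminus H$. A subgroup $P\le S$ is essential if $N_S(P)\in\mathrm{Syl}_p(N_G(P))$ and $N_G(P)/P$ contains a strongly $p$-embedded subgroup. Let $\mathcal{T}_S^e(G)$ be the full subcategory of $\mathcal{T}_S(G)$ whose objects are $S$ and the essential subgroups of $S$. For each $n\ge 0$, regard $H^n(-,M)$ as a contravariant functor on $\mathcal{T}_S(G)$, where $g:P\to Q$ induces the map $H^n(Q,M)\to H^n(P,M)$ coming from the homomorphism $P\to Q$, $x\mapsto g^{-1}xg$, and the map $M\to M$, $m\mapsto gm$. Then there is an isomorphism of graded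 $\mathbb{Z}_{(p)}$-modules $$H^*(G,M)\;\cong\;\varprojlim_{\mathcal{T}_S^e(G)}H^*(-,M),$$ whose component at each object $P$ of $\mathcal{T}_S^e(G)$ is the restriction map $H^*(G,M)\to H^*(P,M)$. -/

import Mathlib

open CategoryTheory CategoryTheory.Limits

universe u

/-- A subgroup `H` of a (finite) group `K` is strongly `p`-embedded if `p` divides `|H|`, `H` is a
proper subgroup, and `p` does not divide `|H ∩ Hᵍ|` for `g ∈ K ∖ H`, where `Hᵍ = g⁻¹ H g`. -/
structure IsStronglyEmbedded (p : ℕ) {K : Type*} [Group K] (H : Subgroup K) : Prop where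
  dvd_card : p ∣ Nat.card H
  ne_top : H ≠ ⊤
  not_dvd_card_inf : ∀ g : K, g ∉ H →
    ¬ p ∣ Nat.card (H ⊓ H.map (MulAut.conj g⁻¹).toMonoidHom : Subgroup K)

/-- The ideal `(p)` of `ℤ` is prime, so that one can localize at it. -/
instance isPrime_span_natCast (p : ℕ) [hp : Fact p.Prime] : (Ideal.span {(p : ℤ)}).IsPrime :=
  (Ideal.span_singleton_prime (Int.natCast_ne_zero.mpr hp.out.ne_zero)).mpr
    (Nat.prime_iff_prime_int.mp hp.out)

/-- The objects of the transporter category of `G` over `S`: all subgroups of `S`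
(as subgroups of `G`). -/
structure Transporter {G : Type u} [Group G] (S : Subgroup G) where
  sub : Subgroup G
  le : sub ≤ S

namespace Transporter

variable {G : Type u} [Group G] {S : Subgroup G}

/-- The transporter category of `G` over `S`: a morphism `P ⟶ Q` is an element `g` of `G` with
`Pᵍ = g⁻¹ P g ≤ Q`. The composite of `g : P ⟶ Q` with `h : Q ⟶ R` is the product `g * h`. -/
instance : Category.{u} (Transporter S) where
  Hom P Q := {g : G // ∀ x ∈ P.sub, g⁻¹ * x * g ∈ Q.sub}
  id P := ⟨1, fun x hx => by simpa using hx⟩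
  comp g h := ⟨g.1 * h.1, fun x hx => by
    simpa [mul_assoc] using h.2 _ (g.2 x hx)⟩
  id_comp g := Subtype.ext (one_mul g.1)
  comp_id g := Subtype.ext (mul_one g.1)
  assoc f g h := Subtype.ext (mul_assoc f.1 g.1 h.1)

/-- The element of `G` underlying a morphism. -/
def elt {P Q : Transporter S} (g : P ⟶ Q) : G := g.1

theorem elt_mem {P Q : Transporter S} (g : P ⟶ Q) {x : G} (hx : x ∈ P.sub) :
    (elt g)⁻¹ * x * elt g ∈ Q.sub := g.2 x hx

theorem elt_id (P : Transporter S) : elt (𝟙 P) = 1 := rfl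

theorem elt_comp {P Q R : Transporter S} (g : P ⟶ Q) (h : Q ⟶ R) :
    elt (g ≫ h) = elt g * elt h := rfl

/-- For finite `G`, the automorphism group of `P` in the transporter category, consisting of the
`g : G` with `Pᵍ ≤ P`, is the normalizer of `P` in `G`. -/
theorem mem_normalizer_iff_conj_mem [Finite G] (P : Transporter S) (g : G) :
    g ∈ Subgroup.normalizer (P.sub : Set G) ↔ ∀ x ∈ P.sub, g⁻¹ * x * g ∈ P.sub := by
  rw [← inv_mem_iff]
  constructor
  · intro h x hx
    simpa using (Subgroup.mem_normalizer_iff.mp h x).mp hx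
  · intro h
    exact Subgroup.mem_normalizer_fintype (fun x hx => by simpa using h x hx)

/-- `P` is essential (at the prime `p`) in the transporter category of `G` over `S`:
with `Aut(P) = N_G(P)`, the subgroup `N_S(P)` is a Sylow `p`-subgroup of `Aut(P)`, and `Aut(P) / P`
contains a strongly `p`-embedded subgroup. -/
structure IsEssential (p : ℕ) (P : Transporter S) : Prop where
  isSylow : ∃ T : Sylow p (Subgroup.normalizer (P.sub : Set G)),
    (T : Subgroup (Subgroup.normalizer (P.sub : Set G))) =
      S.subgroupOf (Subgroup.normalizer (P.sub : Set G))
  exists_stronglyEmbedded :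
    ∃ H : Subgroup (Subgroup.normalizer (P.sub : Set G) ⧸
        P.sub.subgroupOf (Subgroup.normalizer (P.sub : Set G))),
      IsStronglyEmbedded p H

/-- The objects of the essential transporter category: `S` and the essential subgroups of `S`. -/
def essentialObjects (p : ℕ) (S : Subgroup G) : ObjectProperty (Transporter S) :=
  fun P => P.sub = S ∨ P.IsEssential p

/-- The essential transporter category: the full subcategory of the transporter category on `S`
and the essential subgroups of `S`. -/
abbrev Essential (p : ℕ) (S : Subgroup G) := (essentialObjects p S).FullSubcategory

/-- The group homomorphism `P → Q`, `x ↦ g⁻¹ x g`, given by a morphism `g : P ⟶ Q`. -/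
def conjHom {P Q : Transporter S} (g : P ⟶ Q) : P.sub →* Q.sub where
  toFun x := ⟨(elt g)⁻¹ * x * elt g, elt_mem g x.2⟩
  map_one' := by ext; simp
  map_mul' x y := by ext; simp [mul_assoc]

variable {k : Type u} [CommRing k] (M : Rep.{u} k G)

/-- The map `m ↦ g • m` on `M`, which is `P`-equivariant when the source is a representation of `P`
through `P → Q`, `x ↦ g⁻¹ x g`. -/
noncomputable def actHom {P Q : Transporter S} (g : P ⟶ Q) :
    Rep.res (conjHom g) (Rep.res Q.sub.subtype M) ⟶ Rep.res P.sub.subtype M :=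
  Rep.ofHom ⟨M.ρ (elt g), fun x => by
    change M.ρ (elt g) ∘ₗ M.ρ ((elt g)⁻¹ * x * elt g) = M.ρ x ∘ₗ M.ρ (elt g)
    rw [← Module.End.mul_eq_comp, ← Module.End.mul_eq_comp, ← map_mul, ← map_mul]
    simp [mul_assoc]⟩

/-- The contravariant functor `Hⁿ(-, M)` on the transporter category. It sends `P` to `Hⁿ(P, M)`,
and `g : P ⟶ Q` to the map `Hⁿ(Q, M) ⟶ Hⁿ(P, M)` induced by `P → Q`, `x ↦ g⁻¹ x g`, and
`M → M`, `m ↦ g • m`; for `g = 1` this is restriction. -/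
noncomputable def cohomology (n : ℕ) : (Transporter S)ᵒᵖ ⥤ ModuleCat.{u} k where
  obj P := groupCohomology (Rep.res P.unop.sub.subtype M) n
  map g := groupCohomology.map (conjHom g.unop) (actHom M g.unop) n
  map_id P := by
    refine Eq.trans (groupCohomology.map_congr ?_ ?_ n) (groupCohomology.map_id n)
    · ext x
      simp [conjHom, elt_id]
    · ext m
      change M.ρ 1 m = m
      simp
  map_comp {P Q R} g h := by
    refine Eq.trans (groupCohomology.map_congr ?_ ?_ n)
      (groupCohomology.map_comp (conjHom g.unop) (conjHom h.unop)
        (actHom M g.unop) (actHom M h.unop) n)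
    · ext x
      simp [conjHom, elt_comp, mul_assoc]
    · ext m
      change M.ρ (elt h.unop * elt g.unop) m = M.ρ (elt h.unop) (M.ρ (elt g.unop) m)
      simp

/-- The functor `Hⁿ(-, M)` on the essential transporter category. -/
noncomputable def essentialCohomology (p : ℕ) (S : Subgroup G) (n : ℕ) :
    (Essential p S)ᵒᵖ ⥤ ModuleCat.{u} k :=
  (essentialObjects p S).ι.op ⋙ cohomology M n

/-- Restriction `Hⁿ(G, M) ⟶ Hⁿ(P, M)`. -/
noncomputable def restriction (P : Transporter S) (n : ℕ) :
    groupCohomology M n ⟶ groupCohomology (Rep.res P.sub.subtype M) n :=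
  groupCohomology.map P.sub.subtype (𝟙 _) n

end Transporter

/-! A class on `S` is stable if its conjugates agree wherever they are defined. Because `|G : S|` is
a unit in `k`, restriction identifies `Hⁿ(G, M)` with the stable classes in `Hⁿ(S, M)`. By Alperin's
fusion theorem, stability need only be tested on automorphisms of `S` and of the essential
subgroups, and these conditions hold in the limit.

The stable element theorem (`IsStable.exists_comp_map_subtype_eq`, `mono_map_subtype`) rests on the
split equalizer `M → Fun(G/S, M) ⇉ Fun(G/S × G/S, M)`, contracted by averaging over `G/S` and hence
preserved by `Hⁿ(G, -)`. Shapiro's lemma turns the middle term into `Hⁿ(S, M)`. Classes in the last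
term are detected on point stabilizers, which are intersections of two conjugates of `S`; there the
equalizer condition is stability. The explicit Shapiro isomorphism (`isIso_map_coindEval`) and the
triviality of inner conjugation (`map_conjRes`) come from comparing bar resolutions.

The fusion theorem (`IsFusionClosed.of_conj_mem`) is a downward induction on `|P|`. Its core is
`of_mem_normalizer`: if only some automorphisms of `Q` were generated, they would form, modulo `Q`,
a strongly `p`-embedded subgroup, so `Q` would be essential and all its automorphisms available. -/

/-! ### Comparing projective resolutions under `Hom(-, A)` -/

section LinearYoneda

variable {k C : Type*} [CommRing k] [Category* C] [Abelian C] [Linear k C]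

/-- The map `Hom(Q, A) ⟶ Hom(P, A)` of cochain complexes given by a chain map `P ⟶ Q`. -/
noncomputable def ChainComplex.linearYonedaMap (k : Type*) [CommRing k] [Linear k C]
    {P Q : ChainComplex C ℕ} (f : P ⟶ Q) (A : C) :
    Q.linearYonedaObj k A ⟶ P.linearYonedaObj k A :=
  (HomologicalComplex.unopFunctor _ _).map
    ((((linearYoneda k C).obj A).rightOp.mapHomologicalComplex _).map f).op

namespace ChainComplex

lemma linearYonedaMap_comp {P Q R : ChainComplex C ℕ} (f : P ⟶ Q) (g : Q ⟶ R) (A : C) :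
    linearYonedaMap k (f ≫ g) A = linearYonedaMap k g A ≫ linearYonedaMap k f A := by
  simp only [linearYonedaMap, Functor.map_comp, op_comp]
  rfl

lemma linearYonedaMap_id (P : ChainComplex C ℕ) (A : C) :
    linearYonedaMap k (𝟙 P) A = 𝟙 _ := by
  simp only [linearYonedaMap, CategoryTheory.Functor.map_id, op_id]
  rfl

/-- Homotopic chain maps induce homotopic maps on `Hom(-, A)`. -/
noncomputable def linearYonedaMapHomotopy {P Q : ChainComplex C ℕ} {f g : P ⟶ Q}
    (h : Homotopy f g) (A : C) : Homotopy (linearYonedaMap k f A) (linearYonedaMap k g A) :=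
  (((linearYoneda k C).obj A).rightOp.mapHomotopy h).unop

/-- A homotopy equivalence induces a homotopy equivalence on `Hom(-, A)`. -/
noncomputable def linearYonedaHomotopyEquiv {P Q : ChainComplex C ℕ} (e : HomotopyEquiv P Q)
    (A : C) : HomotopyEquiv (Q.linearYonedaObj k A) (P.linearYonedaObj k A) where
  hom := linearYonedaMap k e.hom A
  inv := linearYonedaMap k e.inv A
  homotopyHomInvId := ((Homotopy.ofEq (linearYonedaMap_comp _ _ _)).symm.trans
    (linearYonedaMapHomotopy e.homotopyInvHomId A)).trans (Homotopy.ofEq (linearYonedaMap_id _ _))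
  homotopyInvHomId := ((Homotopy.ofEq (linearYonedaMap_comp _ _ _)).symm.trans
    (linearYonedaMapHomotopy e.homotopyHomInvId A)).trans (Homotopy.ofEq (linearYonedaMap_id _ _))

/-- A comparison map of projective resolutions induces isomorphisms on the cohomology of
`Hom(-, A)`. -/
lemma isIso_homologyMap_linearYonedaMap {Z : C} (P Q : ProjectiveResolution Z)
    (f : P.complex ⟶ Q.complex) (hf : f ≫ Q.π = P.π) (A : C) (n : ℕ) :
    IsIso (HomologicalComplex.homologyMap (linearYonedaMap k f A) n) := by
  have h := linearYonedaMapHomotopy (k := k) (ProjectiveResolution.liftHomotopy (𝟙 Z) f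
    (ProjectiveResolution.homotopyEquiv P Q).hom (by simp [hf]) (by simp)) A
  rw [h.homologyMap_eq]
  exact ((linearYonedaHomotopyEquiv (k := k)
    (ProjectiveResolution.homotopyEquiv P Q) A).toHomologyIso n).isIso_hom

/-- A chain endomorphism of a projective resolution over the identity induces the identity on the
cohomology of `Hom(-, A)`. -/
lemma homologyMap_linearYonedaMap_eq_id {Z : C} (P : ProjectiveResolution Z)
    (f : P.complex ⟶ P.complex) (hf : f ≫ P.π = P.π) (A : C) (n : ℕ) :
    HomologicalComplex.homologyMap (linearYonedaMap k f A) n = 𝟙 _ := by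
  have h := linearYonedaMapHomotopy (k := k) (ProjectiveResolution.liftHomotopy (𝟙 Z) f (𝟙 _)
    (by simp [hf]) (by simp)) A
  rw [h.homologyMap_eq, linearYonedaMap_id, HomologicalComplex.homologyMap_id]

end ChainComplex

end LinearYoneda

namespace HomologicalComplex

variable {C ι : Type*} [Category* C] [Abelian C] {c : ComplexShape ι}

/-- Passes from inhomogeneous cochains, where maps on cohomology are defined, to `Hom` out of a
resolution, where chain homotopies are available. -/
lemma isIso_homologyMap_of_comm {K K' L L' : HomologicalComplex C c} {φ : K ⟶ K'} {ψ : L ⟶ L'}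
    (e : K ≅ L) (e' : K' ≅ L') (h : φ ≫ e'.hom = e.hom ≫ ψ) (n : ι)
    (hψ : IsIso (homologyMap ψ n)) : IsIso (homologyMap φ n) := by
  have : IsIso (homologyMap φ n ≫ homologyMap e'.hom n) := by
    rw [← homologyMap_comp, h, homologyMap_comp]
    infer_instance
  exact IsIso.of_isIso_comp_right _ (homologyMap e'.hom n)

lemma homologyMap_eq_id_of_comm {K L : HomologicalComplex C c} {φ : K ⟶ K} {ψ : L ⟶ L}
    (e : K ≅ L) (h : φ ≫ e.hom = e.hom ≫ ψ) (n : ι) (hψ : homologyMap ψ n = 𝟙 _) :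
    homologyMap φ n = 𝟙 _ := by
  rw [← cancel_mono (homologyMap e.hom n), ← homologyMap_comp, h, homologyMap_comp, hψ,
    Category.id_comp, Category.comp_id]

end HomologicalComplex

/-! ### Functoriality of the bar resolution -/

namespace Rep

open scoped TensorProduct

variable {k G H : Type u} [CommRing k] [Group G] [Group H]

/-- The action of `g` on `A`, as a morphism from the restriction of `A` along `x ↦ g⁻¹ x g`. -/
noncomputable def conjRes (g : G) (A : Rep.{u} k G) :
    res (MulAut.conj g⁻¹).toMonoidHom A ⟶ A :=
  ofHom ⟨A.ρ g, fun x => by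
    change A.ρ g ∘ₗ A.ρ (g⁻¹ * x * g⁻¹⁻¹) = A.ρ x ∘ₗ A.ρ g
    rw [← Module.End.mul_eq_comp, ← Module.End.mul_eq_comp, ← map_mul, ← map_mul]
    simp [mul_assoc]⟩

lemma conjRes_naturality (g : G) {A B : Rep.{u} k G} (f : A ⟶ B) :
    (resFunctor _).map f ≫ conjRes g B = conjRes g A ≫ f := by
  ext x
  exact (hom_comm_apply f g x).symm

/-- The map of bar resolutions induced by a group homomorphism, in degree `n`. -/
noncomputable def barMapX (θ : H →* G) (n : ℕ) :
    free k H (Fin n → H) ⟶ res θ (free k G (Fin n → G)) :=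
  freeLift k H (res θ (free k G (Fin n → G)))
    (fun x => Finsupp.single (θ ∘ x) (MonoidAlgebra.single 1 1))

lemma barMapX_single (θ : H →* G) (n : ℕ) (x : Fin n → H) (h : H) (r : k) :
    (barMapX θ n).hom (Finsupp.single x (MonoidAlgebra.single h r)) =
      Finsupp.single (θ ∘ x) (MonoidAlgebra.single (θ h) r) := by
  refine (Representation.freeLift_single_single (res θ (free k G (Fin n → G))).ρ x h r
    (fun x => Finsupp.single (θ ∘ x) (MonoidAlgebra.single 1 1))).trans ?_
  rw [coe_res_obj_ρ']
  simp

lemma barMapX_d (θ : H →* G) (n : ℕ) :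
    barMapX θ (n + 1) ≫ (resFunctor θ).map (barComplex.d k G n) =
      barComplex.d k H n ≫ barMapX θ n := by
  refine free_ext k H _ _ _ fun x => ?_
  rw [hom_comp, hom_comp, Representation.IntertwiningMap.comp_apply,
    Representation.IntertwiningMap.comp_apply, barComplex.d_single, map_add, map_sum,
    barMapX_single, map_one]
  refine (barComplex.d_single n (k := k) (θ ∘ x)).trans ?_
  refine congrArg₂ (· + ·) (barMapX_single ..).symm (Finset.sum_congr rfl fun j _ => ?_)
  refine Eq.trans ?_ (barMapX_single ..).symm
  rw [map_one, Fin.comp_contractNth _ _ (map_mul θ)]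

/-- The map of bar resolutions induced by a group homomorphism. -/
noncomputable def barMap (θ : H →* G) :
    barComplex k H ⟶ ((resFunctor θ).mapHomologicalComplex _).obj (barComplex k G) where
  f n := barMapX θ n
  comm' i j hij := by
    obtain rfl : j + 1 = i := hij
    rw [Functor.mapHomologicalComplex_obj_d, barComplex.d_def, barComplex.d_def]
    exact barMapX_d θ j

variable (k G) in
/-- The augmentation of the bar resolution. -/
noncomputable def barAugmentation : free k G (Fin 0 → G) ⟶ trivial k G k :=
  (diagonalSuccIsoFree k G 0).inv ≫ standardComplex.ε k G

lemma barResolution_π_f_zero : (barResolution k G).π.f 0 = barAugmentation k G := rfl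

lemma diagonalSuccIsoFree_inv_single (n : ℕ) (x : Fin n → G) :
    (diagonalSuccIsoFree k G n).inv.hom (Finsupp.single x (MonoidAlgebra.single 1 1)) =
      MonoidAlgebra.single ((1 : G) • Fin.partialProd x) 1 := by
  simp only [diagonalSuccIsoFree, diagonalSuccIsoTensorTrivial, Iso.trans_inv, Rep.hom_comp,
    Representation.IntertwiningMap.comp_apply]
  have hfree : (leftRegularTensorTrivialIsoFree k G (Fin n → G)).inv.hom
      (Finsupp.single x (.single 1 1)) = .single (1 : G) 1 ⊗ₜ[k] .single x 1 :=
    Representation.leftRegularTensorTrivialIsoFree_symm_apply_single_single x 1 1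
  rw [hfree]
  have hmap := Representation.linearizeMap_single (k := k)
    (Action.diagonalSuccIsoTensorTrivial G n).inv ((1 : G), x) ((1 : k) * 1)
  have hμ := Representation.LinearizeMonoidal.μ_apply_single_single (k := k)
    (X := Action.leftRegular G) (Y := Action.trivial G (Fin n → G)) (1 : G) x 1 1
  refine ((congrArg (fun z => (Representation.linearizeMap
    (Action.diagonalSuccIsoTensorTrivial G n).inv) z) hμ).trans hmap).trans ?_
  rw [mul_one]
  exact congrArg (MonoidAlgebra.single · 1)
    (Action.diagonalSuccIsoTensorTrivial_inv_hom_apply (G := G) (n := n) 1 x)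

lemma barAugmentation_single (x : Fin 0 → G) :
    (barAugmentation k G).hom (Finsupp.single x (MonoidAlgebra.single 1 1)) = (1 : k) := by
  rw [barAugmentation, hom_comp, Representation.IntertwiningMap.comp_apply]
  refine (congrArg (standardComplex.ε k G).hom (diagonalSuccIsoFree_inv_single 0 x)).trans ?_
  simp [standardComplex.ε, ← Representation.IntertwiningMap.toLinearMap_apply]

/-- Restricted to a subgroup, the bar resolution of `G` is still a projective resolution of the
trivial module; this identity then makes `barMap` a comparison of resolutions. -/
lemma barMap_π (θ : H →* G) :
    barMap θ ≫ ((resFunctor θ).mapHomologicalComplex _).map (barResolution k G).π ≫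
      (HomologicalComplex.singleMapHomologicalComplex (resFunctor θ) (.down ℕ) 0).hom.app _ =
    (barResolution k H).π := by
  refine HomologicalComplex.to_single_hom_ext ?_
  rw [barResolution_π_f_zero, HomologicalComplex.comp_f, HomologicalComplex.comp_f,
    HomologicalComplex.singleMapHomologicalComplex_hom_app_self]
  have h : barMapX θ 0 ≫ (resFunctor θ).map (barAugmentation k G) = barAugmentation k H := by
    refine free_ext k H _ _ _ fun x => ?_
    refine Eq.trans ?_ (barAugmentation_single x).symm
    rw [hom_comp, Representation.IntertwiningMap.comp_apply, barMapX_single, map_one]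
    exact barAugmentation_single _
  refine Eq.trans ?_ h
  rfl

/-- The chain endomorphism `[x₁ | ⋯ | xₙ] ↦ g [g⁻¹x₁g | ⋯ | g⁻¹xₙg]` of the bar resolution, in
degree `n`. -/
noncomputable def barConjX (g : G) (n : ℕ) : free k G (Fin n → G) ⟶ free k G (Fin n → G) :=
  barMapX (MulAut.conj g⁻¹).toMonoidHom n ≫ conjRes g _

/-- The chain endomorphism `[x₁ | ⋯ | xₙ] ↦ g [g⁻¹x₁g | ⋯ | g⁻¹xₙg]` of the bar resolution. -/
noncomputable def barConj (g : G) : barComplex k G ⟶ barComplex k G where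
  f n := barConjX g n
  comm' i j hij := by
    obtain rfl : j + 1 = i := hij
    rw [barComplex.d_def]
    change barConjX g (j + 1) ≫ barComplex.d k G j = barComplex.d k G j ≫ barConjX g j
    rw [barConjX, Category.assoc, ← conjRes_naturality, ← Category.assoc, barMapX_d,
      Category.assoc, barConjX]

/-- The augmentation takes the value 1 on all generators and its target has trivial action. Hence
`barConj g` lifts the identity and is homotopic to it. -/
lemma barConj_π (g : G) : barConj g ≫ (barResolution k G).π = (barResolution k G).π := by
  refine HomologicalComplex.to_single_hom_ext ?_
  refine Eq.trans (HomologicalComplex.comp_f _ _ _) ?_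
  change barConjX g 0 ≫ barAugmentation k G = barAugmentation k G
  refine free_ext k G _ _ _ fun x => ?_
  rw [barConjX, Category.assoc, ← conjRes_naturality, hom_comp,
    Representation.IntertwiningMap.comp_apply, barMapX_single, map_one]
  exact (barAugmentation_single (k := k) (_ : Fin 0 → G)).trans
    (barAugmentation_single (k := k) x).symm

end Rep

/-! ### Inner conjugation and Shapiro's lemma -/

namespace groupCohomology

open Rep

variable {k G : Type u} [CommRing k] [Group G]

/-- Conjugation by `g` together with the action of `g` on `A` acts trivially on `Hⁿ(G, A)`. -/
theorem map_conjRes (g : G) (A : Rep.{u} k G) (n : ℕ) :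
    map (MulAut.conj g⁻¹).toMonoidHom (conjRes g A) n = 𝟙 _ := by
  -- By equivariance, precomposition with `barConj g` turns a cochain `x` into `y ↦ g (x (g⁻¹yg))`.
  have h : cochainsMap (MulAut.conj g⁻¹).toMonoidHom (conjRes g A) ≫
      (inhomogeneousCochainsIso A).hom =
      (inhomogeneousCochainsIso A).hom ≫ ChainComplex.linearYonedaMap k (barConj g) A := by
    ext i x
    refine free_ext k G _ _ _ fun y => ?_
    change (Representation.freeLift A.ρ (fun z => A.ρ g (x ((MulAut.conj g⁻¹).toMonoidHom ∘ z))))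
      (Finsupp.single y (MonoidAlgebra.single 1 1)) =
      (barConjX g i ≫ freeLift k G A x).hom (Finsupp.single y (MonoidAlgebra.single 1 1))
    rw [Representation.freeLift_single_single, Rep.hom_comp,
      Representation.IntertwiningMap.comp_apply, barConjX, Rep.hom_comp,
      Representation.IntertwiningMap.comp_apply, barMapX_single,
      map_one (MulAut.conj g⁻¹).toMonoidHom]
    refine Eq.trans ?_ (hom_comm_apply (freeLift k G A x) g
      (Finsupp.single ((MulAut.conj g⁻¹).toMonoidHom ∘ y) (MonoidAlgebra.single 1 1))).symm
    rw [hom_ofHom, Representation.freeLift_single_single]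
    simp
  exact HomologicalComplex.homologyMap_eq_id_of_comm _ h n
    (ChainComplex.homologyMap_linearYonedaMap_eq_id (barResolution k G) _ (barConj_π g) A n)

/-- Evaluation at `1`. -/
noncomputable def coindEval (S : Subgroup G) (A : Rep.{u} k S) :
    res S.subtype (coind S.subtype A) ⟶ A :=
  (resCoindHomEquiv.{u} S.subtype (coind S.subtype A) A).symm (𝟙 _)

/-- Shapiro's lemma: the isomorphism `Hⁿ(G, Coind_S^G A) ≅ Hⁿ(S, A)` is given by restriction to
`S` and evaluation at `1`. -/
theorem isIso_map_coindEval (S : Subgroup G) (A : Rep.{u} k S) (n : ℕ) :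
    IsIso (map S.subtype (coindEval S A) n) := by
  let P := (resFunctor S.subtype).mapProjectiveResolution (barResolution k G)
  -- Restriction and evaluation amount to Frobenius reciprocity on `Hom` from the bar resolution of
  -- `G`, followed by the comparison `barMap` of resolutions over `S`.
  have h : cochainsMap S.subtype (coindEval S A) ≫
      (inhomogeneousCochainsIso A).hom =
      (inhomogeneousCochainsIso (coind S.subtype A) ≪≫
        (linearYonedaObjResProjectiveResolutionIso (barResolution k G) A).symm).hom ≫
        ChainComplex.linearYonedaMap k (Q := P.complex) (barMap S.subtype) A := by
    ext i x
    refine free_ext k S _ _ _ fun y => ?_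
    change (Representation.freeLift A.ρ (fun z => (x (S.subtype ∘ z)).1 1))
      (Finsupp.single y (MonoidAlgebra.single 1 1)) =
      ((freeLift k G (coind S.subtype A) x).hom ((barMapX S.subtype i).hom
        (Finsupp.single y (MonoidAlgebra.single 1 1)))).1 1
    rw [Representation.freeLift_single_single, barMapX_single]
    refine Eq.trans ?_ (congrArg (fun f : coind S.subtype A => f.1 1)
      (Representation.freeLift_single_single (coind S.subtype A).ρ (S.subtype ∘ y) (S.subtype 1)
        (1 : k) x)).symm
    simp
  exact HomologicalComplex.isIso_homologyMap_of_comm _ _ h n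
    (ChainComplex.isIso_homologyMap_linearYonedaMap (barResolution k S) P
      (barMap S.subtype) (barMap_π _) A n)

end groupCohomology

/-! ### Functions on a `G`-set: averaging and decomposition into orbits -/

namespace Rep

variable {k G : Type u} [CommRing k] [Group G]

lemma hom_ext_apply {A B : Rep.{u} k G} {f g : A ⟶ B} (h : ∀ a, f.hom a = g.hom a) : f = g :=
  Rep.hom_ext (Representation.IntertwiningMap.ext (LinearMap.ext h))

/-- The representation on functions `X → M`, with `g` acting by `(g f) x = g (f (g⁻¹ x))`. -/
noncomputable def funRepresentation (X : Type u) [MulAction G X] (M : Rep.{u} k G) :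
    Representation k G (X → M) where
  toFun g :=
    { toFun f x := M.ρ g (f (g⁻¹ • x))
      map_add' f f' := by ext; simp
      map_smul' r f := by ext; simp }
  map_one' := by ext; simp
  map_mul' g h := LinearMap.ext fun f => funext fun x => by
    change M.ρ (g * h) (f ((g * h)⁻¹ • x)) = M.ρ g (M.ρ h (f (h⁻¹ • g⁻¹ • x)))
    rw [map_mul, Module.End.mul_apply, mul_inv_rev, mul_smul]

/-- The functions `X → M` as an object of `Rep k G`. -/
noncomputable abbrev funRep (X : Type u) [MulAction G X] (M : Rep.{u} k G) : Rep.{u} k G :=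
  Rep.of (funRepresentation X M)

variable {X Y : Type u} [MulAction G X] [MulAction G Y] (M : Rep.{u} k G)

/-- Precomposition with an equivariant map. -/
noncomputable def funComp (p : X →[G] Y) : funRep Y M ⟶ funRep X M :=
  ofHom ⟨LinearMap.funLeft k M p, fun g => by
    refine LinearMap.ext fun f => funext fun x => ?_
    change M.ρ g (f (g⁻¹ • p x)) = M.ρ g (f (p (g⁻¹ • x)))
    rw [map_smul]⟩

/-- The constant functions. -/
noncomputable def funConst (X : Type u) [MulAction G X] : M ⟶ funRep X M :=
  ofHom ⟨LinearMap.pi fun _ => LinearMap.id, fun _ => rfl⟩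

/-- `r` times the sum of the values of a function. -/
noncomputable def funSum [Fintype X] (r : k) : funRep X M ⟶ M :=
  ofHom ⟨
    { toFun f := r • ∑ x, f x
      map_add' f f' := by simp [Finset.sum_add_distrib]
      map_smul' s f := by simp [← Finset.smul_sum, smul_comm r s] },
    fun g => by
      refine LinearMap.ext fun f => ?_
      change r • ∑ x, M.ρ g (f (g⁻¹ • x)) = M.ρ g (r • ∑ x, f x)
      rw [map_smul, map_sum]
      exact congrArg (r • ·) (Equiv.sum_comp (MulAction.toPerm g⁻¹) (fun x => M.ρ g (f x)))⟩

/-- `r` times the sum of the values of a function over the second variable. -/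
noncomputable def funSumSnd [Fintype Y] (r : k) : funRep (X × Y) M ⟶ funRep X M :=
  ofHom ⟨
    { toFun f x := r • ∑ y, f (x, y)
      map_add' f f' := by ext; simp [Finset.sum_add_distrib]
      map_smul' s f := by ext; simp [← Finset.smul_sum, smul_comm r s] },
    fun g => by
      refine LinearMap.ext fun f => funext fun x => ?_
      change r • ∑ y, M.ρ g (f (g⁻¹ • (x, y))) = M.ρ g (r • ∑ y, f (g⁻¹ • x, y))
      rw [map_smul, map_sum]
      exact congrArg (r • ·)
        (Equiv.sum_comp (MulAction.toPerm g⁻¹) (fun y => M.ρ g (f (g⁻¹ • x, y))))⟩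

lemma smul_sum_const {X : Type u} [Fintype X] (r : k) (hr : (Fintype.card X : k) * r = 1) (m : M) :
    r • ∑ _ : X, m = m := by
  rw [Finset.sum_const, Finset.card_univ, ← Nat.cast_smul_eq_nsmul k, smul_smul, mul_comm, hr,
    one_smul]

lemma funConst_comp_funSum [Fintype X] (r : k) (hr : (Fintype.card X : k) * r = 1) :
    funConst M X ≫ funSum M r = 𝟙 M :=
  hom_ext_apply fun m => smul_sum_const M r hr m

lemma funComp_fst_comp_funSumSnd [Fintype X] (r : k) (hr : (Fintype.card X : k) * r = 1) :
    funComp M (MulActionHom.fst G X X) ≫ funSumSnd M r = 𝟙 (funRep X M) :=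
  hom_ext_apply fun f => funext fun x => smul_sum_const M r hr (f x)

/-- With the two preceding identities, this makes `M → Fun(X, M) ⇉ Fun(X × X, M)` a split equalizer
when `r` is inverse to `|X|`: a function with equal pullbacks is constant, equal to its average. -/
lemma funComp_snd_comp_funSumSnd [Fintype X] (r : k) :
    funComp M (MulActionHom.snd G X X) ≫ funSumSnd M r = funSum M r ≫ funConst M X :=
  rfl

/-- Evaluation at `x`, equivariant for a subgroup that fixes `x`. -/
noncomputable def funEval (x : X) {L : Subgroup G} (hL : L ≤ MulAction.stabilizer G x) :
    res L.subtype (funRep X M) ⟶ res L.subtype M :=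
  ofHom ⟨LinearMap.proj x, fun l => by
    refine LinearMap.ext fun f => ?_
    change M.ρ l (f ((l : G)⁻¹ • x)) = M.ρ l (f x)
    rw [MulAction.mem_stabilizer_iff.mp (inv_mem (hL l.2))]⟩

/-- The map `f ↦ (g ↦ g (f (g⁻¹ x)))` to a coinduced representation. -/
noncomputable def funToCoind (x : X) {L : Subgroup G} (hL : L ≤ MulAction.stabilizer G x) :
    funRep X M ⟶ coind L.subtype (res L.subtype M) :=
  resCoindToHom L.subtype _ _ (funEval M x hL)

lemma funToCoind_apply (x : X) {L : Subgroup G} (hL : L ≤ MulAction.stabilizer G x)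
    (f : X → M) (g : G) :
    ((funToCoind M x hL).hom f).1 g = M.ρ g (f (g⁻¹ • x)) := rfl

lemma res_funToCoind_comp_coindEval (x : X) {L : Subgroup G}
    (hL : L ≤ MulAction.stabilizer G x) :
    (resFunctor L.subtype).map (funToCoind M x hL) ≫ groupCohomology.coindEval L _ =
      funEval M x hL := by
  refine hom_ext_apply fun (f : X → M) => ?_
  change M.ρ 1 (f ((1 : G)⁻¹ • x)) = f x
  simp

open Classical in
/-- The values `g (φ (g⁻¹))` at `g x` for `φ` in a coinduced representation, extended by zero
outside of the orbit of `x`. -/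
noncomputable def coindToFunAux (x : X) (L : Subgroup G)
    (φ : coind L.subtype (res L.subtype M)) (y : X) : M :=
  if h : ∃ g : G, g • x = y then M.ρ h.choose (φ.1 h.choose⁻¹) else 0

variable {M} in
-- The chosen element and `g` differ by an element of the stabilizer of `x`, for which `φ` is
-- equivariant, so the choice is immaterial.
lemma coindToFunAux_smul {x : X} {L : Subgroup G} (hL : MulAction.stabilizer G x ≤ L)
    (φ : coind L.subtype (res L.subtype M)) (g : G) :
    coindToFunAux M x L φ (g • x) = M.ρ g (φ.1 g⁻¹) := by
  have h : ∃ g' : G, g' • x = g • x := ⟨g, rfl⟩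
  rw [coindToFunAux, dif_pos h]
  have hl : h.choose⁻¹ * g ∈ L := hL (by
    rw [MulAction.mem_stabilizer_iff, mul_smul, inv_smul_eq_iff, h.choose_spec])
  have := φ.2 ⟨_, hl⟩ g⁻¹
  simp only [Subgroup.subtype_apply, mul_inv_cancel_right] at this
  rw [this]
  change M.ρ _ (M.ρ (h.choose⁻¹ * g) _) = _
  rw [← Module.End.mul_apply, ← map_mul, mul_inv_cancel_left]

variable {M} in
lemma coindToFunAux_of_notMem {x y : X} {L : Subgroup G} (hy : y ∉ MulAction.orbit G x)
    (φ : coind L.subtype (res L.subtype M)) : coindToFunAux M x L φ y = 0 :=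
  dif_neg fun h => hy h

/-- The map from a coinduced representation to a representation on functions, with image the
functions on an orbit. -/
noncomputable def coindToFun (x : X) {L : Subgroup G} (hL : MulAction.stabilizer G x ≤ L) :
    coind L.subtype (res L.subtype M) ⟶ funRep X M :=
  ofHom ⟨
    { toFun := coindToFunAux M x L
      map_add' φ ψ := by
        funext y
        change _ = coindToFunAux M x L φ y + coindToFunAux M x L ψ y
        by_cases hy : y ∈ MulAction.orbit G x
        · obtain ⟨g, rfl⟩ := hy
          simp only [coindToFunAux_smul hL]
          exact map_add _ _ _
        · simp only [coindToFunAux_of_notMem hy, add_zero]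
      map_smul' r φ := by
        funext y
        change _ = r • coindToFunAux M x L φ y
        by_cases hy : y ∈ MulAction.orbit G x
        · obtain ⟨g, rfl⟩ := hy
          simp only [coindToFunAux_smul hL]
          exact map_smul _ _ _
        · simp only [coindToFunAux_of_notMem hy, smul_zero] },
    fun h => by
      refine LinearMap.ext fun φ => funext fun y => ?_
      change coindToFunAux M x L ((coind L.subtype (res L.subtype M)).ρ h φ) y =
        M.ρ h (coindToFunAux M x L φ (h⁻¹ • y))
      by_cases hy : y ∈ MulAction.orbit G x
      · obtain ⟨g, rfl⟩ := hy
        simp only [smul_smul, coindToFunAux_smul hL]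
        rw [← Module.End.mul_apply, ← map_mul, mul_inv_cancel_left, mul_inv_rev, inv_inv]
        rfl
      · rw [coindToFunAux_of_notMem hy, coindToFunAux_of_notMem, map_zero]
        rintro ⟨g, hg⟩
        exact hy ⟨h * g, (mul_smul h g x).trans
          ((congrArg (h • ·) hg).trans (smul_inv_smul h y))⟩⟩

lemma coindToFun_comp_funToCoind (x : X) {L : Subgroup G} (hL : L = MulAction.stabilizer G x) :
    coindToFun M x hL.ge ≫ funToCoind M x hL.le = 𝟙 _ := by
  refine hom_ext_apply fun φ => ?_
  refine Subtype.ext (funext fun g => ?_)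
  change M.ρ g (coindToFunAux M x L φ (g⁻¹ • x)) = φ.1 g
  rw [coindToFunAux_smul hL.ge, ← Module.End.mul_apply, ← map_mul]
  simp

open Classical in
lemma funToCoind_comp_coindToFun_apply (x : X) {L : Subgroup G}
    (hL : L = MulAction.stabilizer G x) (f : X → M) (y : X) :
    ((funToCoind M x hL.le ≫ coindToFun M x hL.ge).hom f : X → M) y =
      if y ∈ MulAction.orbit G x then f y else 0 := by
  change coindToFunAux M x L ((funToCoind M x hL.le).hom f) y = _
  split_ifs with hy
  · obtain ⟨g, rfl⟩ := hy
    rw [coindToFunAux_smul hL.ge, funToCoind_apply, ← Module.End.mul_apply, ← map_mul]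
    simp
  · exact coindToFunAux_of_notMem hy _

/-- Each summand is the projector onto the functions supported on one orbit. -/
lemma sum_funToCoind_comp_coindToFun [Fintype (MulAction.orbitRel.Quotient G X)] :
    ∑ O : MulAction.orbitRel.Quotient G X,
      funToCoind M O.out le_rfl ≫ coindToFun M O.out le_rfl = 𝟙 (funRep X M) := by
  classical
  refine hom_ext_apply fun f => funext fun y => ?_
  have hsum : ((∑ O : MulAction.orbitRel.Quotient G X,
      funToCoind M O.out le_rfl ≫ coindToFun M O.out le_rfl).hom f : X → M) y =
      ∑ O : MulAction.orbitRel.Quotient G X,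
        ((funToCoind M O.out le_rfl ≫ coindToFun M O.out le_rfl).hom f : X → M) y := by
    rw [Rep.sum_hom, Representation.IntertwiningMap.sum_apply, Finset.sum_apply]
  rw [hsum]
  simp only [funToCoind_comp_coindToFun_apply M _ rfl]
  rw [Finset.sum_eq_single (Quotient.mk _ y)]
  · exact if_pos (MulAction.orbitRel_apply.mp (Quotient.exact (Quotient.out_eq _).symm))
  · intro O _ hO
    refine if_neg fun hy => hO ?_
    rw [← Quotient.out_eq O]
    exact (Quotient.sound (MulAction.orbitRel_apply.mpr hy)).symm
  · simp

end Rep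

/-! ### Cohomology with coefficients in functions on a `G`-set -/

namespace groupCohomology

open Rep

variable {k G : Type u} [CommRing k] [Group G]

/-- Carries the decomposition into orbits over to cohomology. -/
instance (n : ℕ) : (functor k G n).Additive :=
  inferInstanceAs (cochainsFunctor k G ⋙ HomologicalComplex.homologyFunctor _ _ n).Additive

variable {X : Type u} [MulAction G X] (M : Rep.{u} k G)

/-- The second factor is Shapiro's isomorphism, so evaluation at `x` is governed by a map of
coefficients over `G`. -/
lemma map_funEval_eq (x : X) {L : Subgroup G} (hL : L ≤ MulAction.stabilizer G x) (n : ℕ) :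
    map L.subtype (funEval M x hL) n =
      map (MonoidHom.id G) (funToCoind M x hL) n ≫ map L.subtype (coindEval L _) n := by
  rw [← map_comp]
  exact map_congr rfl (congrArg (fun f => f.hom.toLinearMap)
    (res_funToCoind_comp_coindEval M x hL).symm) n

/-- The map `Hⁿ(G, Fun(X, M)) ⟶ Hⁿ(L, M)` given by evaluation at `x` is a split epimorphism when
`L` is the stabilizer of `x`. -/
lemma exists_comp_map_funEval_eq_id (x : X) {L : Subgroup G}
    (hL : L = MulAction.stabilizer G x) (n : ℕ) :
    ∃ σ : groupCohomology (res L.subtype M) n ⟶ groupCohomology (funRep X M) n,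
      σ ≫ map L.subtype (funEval M x hL.le) n = 𝟙 _ := by
  have := isIso_map_coindEval L (res L.subtype M) n
  refine ⟨inv (map L.subtype (coindEval L (res L.subtype M)) n) ≫
    map (MonoidHom.id G) (coindToFun M x hL.ge) n, ?_⟩
  rw [map_funEval_eq, Category.assoc, ← map_id_comp_assoc, coindToFun_comp_funToCoind M x hL, map_id,
    Category.id_comp, IsIso.inv_hom_id]

/-- The evaluation maps `Hⁿ(G, Fun(X, M)) ⟶ Hⁿ(G_x, M)` are jointly monic. -/
lemma hom_ext_funEval [Finite X] {n : ℕ} {T : ModuleCat.{u} k}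
    {z w : T ⟶ groupCohomology (funRep X M) n}
    (h : ∀ x : X, z ≫ map (MulAction.stabilizer G x).subtype (funEval M x le_rfl) n =
      w ≫ map (MulAction.stabilizer G x).subtype (funEval M x le_rfl) n) : z = w := by
  have := Fintype.ofFinite (MulAction.orbitRel.Quotient G X)
  -- The identity factors through modules coinduced from stabilizers, one per orbit, and Shapiro's
  -- isomorphism detects each by evaluation.
  have hid : 𝟙 (groupCohomology (funRep X M) n) = ∑ O : MulAction.orbitRel.Quotient G X,
      map (MonoidHom.id G) (funToCoind M O.out le_rfl) n ≫
        map (MonoidHom.id G) (coindToFun M O.out le_rfl) n := by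
    refine ((functor k G n).map_id (funRep X M)).symm.trans ?_
    rw [← sum_funToCoind_comp_coindToFun, Functor.map_sum]
    exact Finset.sum_congr rfl fun O _ => map_id_comp ..
  rw [← Category.comp_id z, ← Category.comp_id w, hid, Preadditive.comp_sum, Preadditive.comp_sum]
  refine Finset.sum_congr rfl fun O _ => ?_
  have := isIso_map_coindEval _ (res (MulAction.stabilizer G O.out).subtype M) n
  have hO := h O.out
  rw [map_funEval_eq, ← Category.assoc, ← Category.assoc, cancel_mono] at hO
  rw [← Category.assoc, hO, Category.assoc]

/-- Evaluation at `g x` is evaluation at `x` followed by conjugation by `g`. -/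
lemma map_funEval_smul (g : G) (x : X) {L L' : Subgroup G} (hL : L ≤ MulAction.stabilizer G x)
    (hL' : L' ≤ MulAction.stabilizer G (g • x)) (θ : L' →* L)
    (hθ : ∀ l, (θ l : G) = g⁻¹ * l * g)
    (φ : res θ (res L.subtype M) ⟶ res L'.subtype M) (hφ : ∀ m : M, φ.hom m = M.ρ g m) (n : ℕ) :
    map L'.subtype (funEval M (g • x) hL') n = map L.subtype (funEval M x hL) n ≫ map θ φ n := by
  -- Conjugation by `g` is the identity on `Hⁿ(G, Fun(X, M))`; once it is inserted, both sides come
  -- from the same maps of groups and coefficients.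
  rw [← Category.id_comp (map L'.subtype _ n), ← map_conjRes g, ← map_comp, ← map_comp]
  refine map_congr ?_ ?_ n
  · ext l
    simp [hθ]
  · refine LinearMap.ext fun (f : X → M) => ?_
    refine Eq.trans ?_ (hφ (f x)).symm
    change M.ρ g (f (g⁻¹ • g • x)) = M.ρ g (f x)
    rw [inv_smul_smul]

end groupCohomology

/-! ### Stable elements -/

namespace groupCohomology

open Rep

variable {k G : Type u} [CommRing k] [Group G] (M : Rep.{u} k G)

/-- The homomorphism `P → Q`, `x ↦ g⁻¹ x g`, for `g⁻¹ P g ≤ Q`. -/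
def conjSubgroupHom {P Q : Subgroup G} (g : G) (h : ∀ x ∈ P, g⁻¹ * x * g ∈ Q) : P →* Q where
  toFun x := ⟨g⁻¹ * x * g, h x x.2⟩
  map_one' := by ext; simp
  map_mul' x y := by ext; simp [mul_assoc]

/-- The action of `g` on `M`, equivariant with respect to `x ↦ g⁻¹ x g`. -/
noncomputable def conjSubgroupRes {P Q : Subgroup G} (g : G) (h : ∀ x ∈ P, g⁻¹ * x * g ∈ Q) :
    res (conjSubgroupHom g h) (res Q.subtype M) ⟶ res P.subtype M :=
  ofHom ⟨M.ρ g, fun x => by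
    change M.ρ g ∘ₗ M.ρ (g⁻¹ * x * g) = M.ρ x ∘ₗ M.ρ g
    rw [← Module.End.mul_eq_comp, ← Module.End.mul_eq_comp, ← map_mul, ← map_mul]
    simp [mul_assoc]⟩

/-- The map `Hⁿ(Q, M) ⟶ Hⁿ(P, M)` induced by conjugation by `g`, for `g⁻¹ P g ≤ Q`. -/
noncomputable def conjMap {P Q : Subgroup G} (g : G) (h : ∀ x ∈ P, g⁻¹ * x * g ∈ Q) (n : ℕ) :
    groupCohomology (res Q.subtype M) n ⟶ groupCohomology (res P.subtype M) n :=
  map (conjSubgroupHom g h) (conjSubgroupRes M g h) n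

lemma conjMap_comp {P Q R : Subgroup G} (g h : G) (hg : ∀ x ∈ P, g⁻¹ * x * g ∈ Q)
    (hh : ∀ x ∈ Q, h⁻¹ * x * h ∈ R) (hgh : ∀ x ∈ P, (g * h)⁻¹ * x * (g * h) ∈ R) (n : ℕ) :
    conjMap M h hh n ≫ conjMap M g hg n = conjMap M (g * h) hgh n := by
  refine (map_comp ..).symm.trans (map_congr ?_ ?_ n)
  · ext x
    simp [conjSubgroupHom, mul_assoc]
  · exact (map_mul M.ρ g h).symm

/-- The product is a variable `j`, so that factorizations such as `g = g * 1` can be used in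
rewriting. -/
lemma conjMap_comp_of_eq {P Q R : Subgroup G} {g h j : G} (hj : j = g * h)
    (hg : ∀ x ∈ P, g⁻¹ * x * g ∈ Q) (hh : ∀ x ∈ Q, h⁻¹ * x * h ∈ R)
    (hgh : ∀ x ∈ P, j⁻¹ * x * j ∈ R) (n : ℕ) :
    conjMap M h hh n ≫ conjMap M g hg n = conjMap M j hgh n := by
  subst hj
  exact conjMap_comp ..

/-- Conjugation by `g` is trivial on `Hⁿ(G, M)`, so restrictions from `G` are compatible with every
transporter morphism. -/
lemma map_subtype_comp_conjMap {P Q : Subgroup G} (g : G) (h : ∀ x ∈ P, g⁻¹ * x * g ∈ Q)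
    (n : ℕ) :
    map Q.subtype (𝟙 (res Q.subtype M)) n ≫ conjMap M g h n =
      map P.subtype (𝟙 (res P.subtype M)) n := by
  rw [← Category.id_comp (map P.subtype _ n), ← map_conjRes g]
  refine (map_comp ..).symm.trans (Eq.trans (map_congr ?_ ?_ n) (map_comp ..))
  · ext x
    simp [conjSubgroupHom]
  · rfl

lemma map_funEval_smul_eq_conjMap {X : Type u} [MulAction G X] (g : G) (x : X)
    {L L' : Subgroup G} (hL : L ≤ MulAction.stabilizer G x)
    (hL' : L' ≤ MulAction.stabilizer G (g • x)) (h : ∀ l ∈ L', g⁻¹ * l * g ∈ L) (n : ℕ) :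
    map L'.subtype (funEval M (g • x) hL') n =
      map L.subtype (funEval M x hL) n ≫ conjMap M g h n :=
  map_funEval_smul M g x hL hL' _ (fun _ => rfl) _ (fun _ => rfl) n

variable {M} {n : ℕ} {T : ModuleCat.{u} k}

/-- An element of `Hⁿ(S, M)` is stable if its images under `Hⁿ(S, M) ⟶ Hⁿ(P, M)` induced by
conjugation and by inclusion agree for all `P ≤ S`. -/
def IsStable {S : Subgroup G} (x : T ⟶ groupCohomology (res S.subtype M) n) : Prop :=
  ∀ (P : Subgroup G) (g : G) (h1 : ∀ y ∈ P, 1⁻¹ * y * 1 ∈ S) (hg : ∀ y ∈ P, g⁻¹ * y * g ∈ S),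
    x ≫ conjMap M g hg n = x ≫ conjMap M 1 h1 n

/-- `L` need not lie in `S`: stability is applied to `g⁻¹Lg ≤ S` and `g⁻¹h`, then pulled back along
conjugation by `g`. -/
lemma IsStable.comp_conjMap_eq {S : Subgroup G}
    {x : T ⟶ groupCohomology (res S.subtype M) n} (hx : IsStable x) {L : Subgroup G} (g h : G)
    (hg : ∀ y ∈ L, g⁻¹ * y * g ∈ S) (hh : ∀ y ∈ L, h⁻¹ * y * h ∈ S) :
    x ≫ conjMap M g hg n = x ≫ conjMap M h hh n := by
  let P := L.comap (MulAut.conj g).toMonoidHom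
  have hLP : ∀ y ∈ L, g⁻¹ * y * g ∈ P := fun y hy => by
    change g * (g⁻¹ * y * g) * g⁻¹ ∈ L
    simpa [mul_assoc] using hy
  have h1 : ∀ y ∈ P, 1⁻¹ * y * 1 ∈ S := fun y hy => by
    simpa [mul_assoc] using hg _ hy
  have h2 : ∀ y ∈ P, (g⁻¹ * h)⁻¹ * y * (g⁻¹ * h) ∈ S := fun y hy => by
    simpa [mul_assoc] using hh _ hy
  rw [← conjMap_comp_of_eq M (mul_one g).symm hLP h1, ← Category.assoc, ← hx P _ h1 h2,
    Category.assoc, conjMap_comp_of_eq M (mul_inv_cancel_left g h).symm hLP h2]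

lemma map_const_comp_map_funEval {X : Type u} [MulAction G X] (x : X) {L : Subgroup G}
    (hL : L ≤ MulAction.stabilizer G x) :
    map (MonoidHom.id G) (funConst M X) n ≫ map L.subtype (funEval M x hL) n =
      map L.subtype (𝟙 (res L.subtype M)) n := by
  rw [← map_comp]
  rfl

lemma map_funComp_comp_map_funEval {X Y : Type u} [MulAction G X] [MulAction G Y] (p : X →[G] Y)
    (x : X) {L : Subgroup G} (hL : L ≤ MulAction.stabilizer G x)
    (hL' : L ≤ MulAction.stabilizer G (p x)) :
    map (MonoidHom.id G) (funComp M p) n ≫ map L.subtype (funEval M x hL) n =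
      map L.subtype (funEval M (p x) hL') n := by
  rw [← map_comp]
  rfl

lemma inv_mul_mul_mem_of_mem_stabilizer (S : Subgroup G) {g l : G}
    (hl : l ∈ MulAction.stabilizer G (g • ((1 : G) : G ⧸ S))) : g⁻¹ * l * g ∈ S := by
  rw [← MulAction.stabilizer_quotient S, MulAction.mem_stabilizer_iff, mul_smul, mul_smul,
    MulAction.mem_stabilizer_iff.mp hl, inv_smul_smul]

lemma smul_one_quotient (S : Subgroup G) (a : G ⧸ S) : ∃ g : G, a = g • ((1 : G) : G ⧸ S) := by
  obtain ⟨g, rfl⟩ := QuotientGroup.mk_surjective a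
  exact ⟨g, by rw [MulAction.Quotient.smul_coe, smul_eq_mul, mul_one]⟩

/-- Stable elements of `Hⁿ(S, M)` are restrictions from `G`, if the index of `S` is invertible. -/
theorem IsStable.exists_comp_map_subtype_eq [Finite G] {S : Subgroup G} {r : k}
    (hr : (S.index : k) * r = 1) {x : T ⟶ groupCohomology (res S.subtype M) n}
    (hx : IsStable x) :
    ∃ y : T ⟶ groupCohomology M n, y ≫ map S.subtype (𝟙 (res S.subtype M)) n = x := by
  have := Fintype.ofFinite (G ⧸ S)
  have hr' : (Fintype.card (G ⧸ S) : k) * r = 1 := by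
    rwa [← Nat.card_eq_fintype_card]
  have ho : S = MulAction.stabilizer G ((1 : G) : G ⧸ S) :=
    (MulAction.stabilizer_quotient S).symm
  -- `x ≫ σ` is a class with coefficients in `Fun(G/S, M)` whose value at the base coset is `x`,
  -- hence whose value at `gS` is the conjugate of `x` by `g`.
  obtain ⟨σ, hσ⟩ := exists_comp_map_funEval_eq_id M ((1 : G) : G ⧸ S) ho n
  have hconj (g : G) {L : Subgroup G} (h : ∀ l ∈ L, g⁻¹ * l * g ∈ S)
      (hL : L ≤ MulAction.stabilizer G (g • ((1 : G) : G ⧸ S))) :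
      (x ≫ σ) ≫ map L.subtype (funEval M _ hL) n = x ≫ conjMap M g h n := by
    rw [map_funEval_smul_eq_conjMap M g _ ho.le hL h, Category.assoc, reassoc_of% hσ]
  -- At a point `(gS, hS)` the two pullbacks are the conjugates of `x` by `g` and by `h`, equal by
  -- stability.
  have heq : (x ≫ σ) ≫ map (MonoidHom.id G) (funComp M (MulActionHom.fst G (G ⧸ S) (G ⧸ S))) n =
      (x ≫ σ) ≫ map (MonoidHom.id G) (funComp M (MulActionHom.snd G (G ⧸ S) (G ⧸ S))) n := by
    refine hom_ext_funEval M fun ⟨a, b⟩ => ?_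
    obtain ⟨g, rfl⟩ := smul_one_quotient S a
    obtain ⟨h, rfl⟩ := smul_one_quotient S b
    have hg : MulAction.stabilizer G (g • ((1 : G) : G ⧸ S), h • ((1 : G) : G ⧸ S)) ≤
        MulAction.stabilizer G (g • ((1 : G) : G ⧸ S)) := fun l hl => congrArg Prod.fst hl
    have hh : MulAction.stabilizer G (g • ((1 : G) : G ⧸ S), h • ((1 : G) : G ⧸ S)) ≤
        MulAction.stabilizer G (h • ((1 : G) : G ⧸ S)) := fun l hl => congrArg Prod.snd hl
    have hfst := map_funComp_comp_map_funEval (M := M) (n := n)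
      (MulActionHom.fst G (G ⧸ S) (G ⧸ S)) (g • ((1 : G) : G ⧸ S), h • ((1 : G) : G ⧸ S)) le_rfl hg
    have hsnd := map_funComp_comp_map_funEval (M := M) (n := n)
      (MulActionHom.snd G (G ⧸ S) (G ⧸ S)) (g • ((1 : G) : G ⧸ S), h • ((1 : G) : G ⧸ S)) le_rfl hh
    rw [Category.assoc (x ≫ σ), Category.assoc (x ≫ σ), hfst, hsnd]
    refine (hconj g (fun l hl => inv_mul_mul_mem_of_mem_stabilizer S (hg hl)) hg).trans
      (Eq.trans ?_ (hconj h (fun l hl => inv_mul_mul_mem_of_mem_stabilizer S (hh hl)) hh).symm)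
    exact hx.comp_conjMap_eq g h _ _
  -- By the split equalizer, `x ≫ σ` is the constant class on its average; evaluation at the base
  -- coset recovers `x`.
  refine ⟨(x ≫ σ) ≫ map (MonoidHom.id G) (funSum M r) n, ?_⟩
  rw [← map_const_comp_map_funEval ((1 : G) : G ⧸ S) ho.le, Category.assoc (x ≫ σ),
    ← map_id_comp_assoc, ← funComp_snd_comp_funSumSnd, map_id_comp_assoc,
    ← Category.assoc (x ≫ σ), ← heq, Category.assoc (x ≫ σ), ← map_id_comp_assoc,
    funComp_fst_comp_funSumSnd M r hr', map_id, Category.id_comp, Category.assoc, hσ,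
    Category.comp_id]

/-- Restriction to `S` is monic, if the index of `S` is invertible. -/
theorem mono_map_subtype [Finite G] {S : Subgroup G} {r : k} (hr : (S.index : k) * r = 1) :
    Mono (map S.subtype (𝟙 (res S.subtype M)) n) where
  right_cancellation {T} y z hyz := by
    have := Fintype.ofFinite (G ⧸ S)
    have hr' : (Fintype.card (G ⧸ S) : k) * r = 1 := by
      rwa [← Nat.card_eq_fintype_card]
    -- The value at `gS` of a constant class is its restriction to the stabilizer, which is a
    -- conjugate of the restriction to `S`. Averaging then cancels `funConst`.
    have h : y ≫ map (MonoidHom.id G) (funConst M (G ⧸ S)) n =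
        z ≫ map (MonoidHom.id G) (funConst M (G ⧸ S)) n := by
      refine hom_ext_funEval M fun a => ?_
      obtain ⟨g, rfl⟩ := smul_one_quotient S a
      rw [Category.assoc, Category.assoc, map_const_comp_map_funEval,
        ← map_subtype_comp_conjMap M g (fun _ => inv_mul_mul_mem_of_mem_stabilizer S),
      reassoc_of% hyz]
    rw [← Category.comp_id y, ← Category.comp_id z, ← map_id n, ← funConst_comp_funSum M r hr',
      map_id_comp, reassoc_of% h]

end groupCohomology

/-! ### Sylow subgroups and normalizers -/

section SylowLemmas

variable {p : ℕ} [Fact p.Prime] {K : Type*} [Group K] [Finite K]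

/-- A `p`-subgroup can be conjugated into a given Sylow `p`-subgroup. -/
lemma Sylow.exists_forall_inv_mul_mul_mem (T : Sylow p K) {U : Subgroup K} (hU : IsPGroup p U) :
    ∃ a : K, ∀ x ∈ U, a⁻¹ * x * a ∈ T := by
  obtain ⟨T', hT'⟩ := hU.exists_le_sylow
  obtain ⟨a, rfl⟩ := MulAction.exists_smul_eq K T T'
  refine ⟨a, fun x hx => ?_⟩
  obtain ⟨y, hy, rfl⟩ := hT' hx
  simpa [mul_assoc] using hy

/-- A `p`-subgroup of `H` can be conjugated by an element of `H` into a given Sylow `p`-subgroup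
that is contained in `H`. -/
lemma Sylow.exists_mem_forall_inv_mul_mul_mem (T : Sylow p K) {H U : Subgroup K}
    (hT : (T : Subgroup K) ≤ H) (hU : IsPGroup p U) (hUH : U ≤ H) :
    ∃ a ∈ H, ∀ x ∈ U, a⁻¹ * x * a ∈ T := by
  obtain ⟨a, ha⟩ := (T.subtype hT).exists_forall_inv_mul_mul_mem (U := U.subgroupOf H)
    (hU.comap_of_injective _ Subtype.val_injective)
  exact ⟨a, a.2, fun x hx => ha ⟨x, hUH hx⟩ hx⟩

/-- A `p`-subgroup of at least the order of a Sylow subgroup is a Sylow subgroup. -/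
lemma IsPGroup.exists_sylow_eq_of_card_le {K' : Type*} [Group K'] [Finite K']
    (hK : Nat.card K' = Nat.card K) (T : Sylow p K') {U : Subgroup K} (hU : IsPGroup p U)
    (hT : Nat.card T ≤ Nat.card U) : ∃ T' : Sylow p K, (T' : Subgroup K) = U := by
  obtain ⟨T', hT'⟩ := hU.exists_le_sylow
  refine ⟨T', (Subgroup.eq_of_le_of_card_ge hT' ?_).symm⟩
  rw [T'.card_eq_multiplicity, ← hK, ← T.card_eq_multiplicity]
  exact hT

/-- A proper subgroup of a `p`-group is proper in its normalizer. -/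
lemma IsPGroup.exists_mem_normalizer_notMem {S P : Subgroup K} (hS : IsPGroup p S) (hP : P < S) :
    ∃ x ∈ S, x ∈ Subgroup.normalizer (P : Set K) ∧ x ∉ P := by
  have := hS.isNilpotent
  have hlt : P.subgroupOf S < ⊤ := by
    rw [lt_top_iff_ne_top, Ne, Subgroup.subgroupOf_eq_top]
    exact hP.not_ge
  obtain ⟨x, hx, hxP⟩ := SetLike.exists_of_lt (Group.normalizerCondition_of_isNilpotent _ hlt)
  refine ⟨x, x.2, ?_, hxP⟩
  rw [Subgroup.mem_normalizer_iff] at hx ⊢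
  intro y
  refine ⟨fun hy => (hx ⟨y, hP.le hy⟩).mp hy, fun hy => ?_⟩
  have hyS : y ∈ S := by
    have := S.mul_mem (S.mul_mem (S.inv_mem x.2) (hP.le hy)) x.2
    simpa [mul_assoc] using this
  exact (hx ⟨y, hyS⟩).mpr hy

omit [Finite K] in
lemma Subgroup.inv_mul_mul_mem_normalizer {P Q : Subgroup K} {a v : K}
    (ha : ∀ x, x ∈ P ↔ a⁻¹ * x * a ∈ Q) (hv : v ∈ normalizer (P : Set K)) :
    a⁻¹ * v * a ∈ normalizer (Q : Set K) := by
  rw [mem_normalizer_iff] at hv ⊢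
  intro y
  have h := hv (a * y * a⁻¹)
  rw [ha, ha] at h
  simpa [mul_assoc] using h

end SylowLemmas

/-! ### Alperin's fusion theorem -/

namespace Transporter

variable {p : ℕ} {G : Type u} [Group G]

/-- A collection of morphisms `g : P → S` in the transporter category that is closed under
composition and inverses and contains the automorphisms of `S` and of the essential subgroups. -/
structure IsFusionClosed (p : ℕ) (S : Subgroup G) (R : Subgroup G → G → Prop) : Prop where
  one : ∀ P ≤ S, R P 1
  mul : ∀ {P Q : Subgroup G} {g h : G}, (∀ x ∈ P, g⁻¹ * x * g ∈ Q) → R P g → R Q h → R P (g * h)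
  inv : ∀ {P Q : Subgroup G} {g : G}, Q ≤ S → (∀ x ∈ P, g⁻¹ * x * g ∈ Q) →
    (∀ x ∈ Q, g * x * g⁻¹ ∈ P) → R P g → R Q g⁻¹
  aut : ∀ Q : Transporter S, essentialObjects p S Q →
    ∀ g ∈ Subgroup.normalizer (Q.sub : Set G), R Q.sub g

namespace IsFusionClosed

variable {S : Sylow p G} {R : Subgroup G → G → Prop} (hR : IsFusionClosed p (S : Subgroup G) R)

include hR

lemma mono {P Q : Subgroup G} {g : G} (hPQ : P ≤ Q) (hQ : Q ≤ S) (h : R Q g) : R P g := by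
  have := hR.mul (P := P) (g := 1) (by simpa using fun x hx => hPQ hx)
    (hR.one P (hPQ.trans hQ)) h
  rwa [one_mul] at this

lemma of_mem {P : Subgroup G} (hP : P ≤ S) {s : G} (hs : s ∈ S) : R P s :=
  hR.mono hP le_rfl (hR.aut ⟨S, le_rfl⟩ (Or.inl rfl) s (Subgroup.le_normalizer hs))

variable [Fact p.Prime] [Finite G]

/-- If all morphisms from larger subgroups belong to `R`, then a morphism in `R` leads from `P` to
any conjugate `Q` of `P` for which `N_S(Q)` is a Sylow subgroup of `N_G(Q)`. -/
lemma exists_conj {P Q : Subgroup G} (hP : P < S)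
    (ih : ∀ V : Subgroup G, Nat.card P < Nat.card V → V ≤ S → ∀ g : G,
      (∀ x ∈ V, g⁻¹ * x * g ∈ S) → R V g)
    {a : G} (ha : ∀ x, x ∈ P ↔ a⁻¹ * x * a ∈ Q)
    {T : Sylow p (Subgroup.normalizer (Q : Set G))}
    (hT : (T : Subgroup (Subgroup.normalizer (Q : Set G))) =
      (S : Subgroup G).subgroupOf (Subgroup.normalizer (Q : Set G))) :
    ∃ h : G, (∀ x, x ∈ P ↔ h⁻¹ * x * h ∈ Q) ∧ R P h := by
  -- `V = N_S(P)` is larger than `P`, and `U` is `a⁻¹Va` inside `N_G(Q)`. An element `c` of `N_G(Q)`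
  -- moves `U` into the Sylow subgroup `N_S(Q)`, so `a * c` takes `P` to `Q` and `V` into `S`.
  let V : Subgroup G := S ⊓ Subgroup.normalizer (P : Set G)
  let U : Subgroup (Subgroup.normalizer (Q : Set G)) :=
    V.comap ((MulAut.conj a).toMonoidHom.comp (Subgroup.subtype _))
  have hU : IsPGroup p U := (S.isPGroup'.to_le inf_le_left).comap_of_injective _
    ((MulAut.conj a).injective.comp Subtype.val_injective)
  obtain ⟨c, hc⟩ := T.exists_forall_inv_mul_mul_mem hU
  have hconj : ∀ x, x ∈ P ↔ (a * c)⁻¹ * x * (a * c) ∈ Q := by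
    intro x
    rw [ha x, Subgroup.mem_normalizer_iff''.mp c.2]
    simp [mul_assoc]
  refine ⟨a * c, hconj, ?_⟩
  have hPV : P ≤ V := le_inf hP.le Subgroup.le_normalizer
  refine hR.mono hPV inf_le_left (ih V ?_ inf_le_left _ fun v hv => ?_)
  · obtain ⟨x, hxS, hxN, hxP⟩ := S.isPGroup'.exists_mem_normalizer_notMem hP
    have hlt : P < V := SetLike.lt_iff_le_and_exists.mpr ⟨hPV, x, Subgroup.mem_inf.mpr ⟨hxS, hxN⟩, hxP⟩
    exact Set.Finite.card_lt_card (Set.toFinite _) hlt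
  · have hv' := hc ⟨a⁻¹ * v * a, Subgroup.inv_mul_mul_mem_normalizer ha hv.2⟩
      (by change a * (a⁻¹ * v * a) * a⁻¹ ∈ V; simpa [mul_assoc] using hv)
    rw [← SetLike.mem_coe, ← Sylow.coe_coe, hT] at hv'
    have : (c : G)⁻¹ * (a⁻¹ * v * a) * c ∈ S := hv'
    simpa [mul_assoc] using this

/-- If all morphisms from larger subgroups belong to `R`, and `N_S(Q)` is a Sylow subgroup of
`N_G(Q)`, then all automorphisms of `Q` belong to `R`. -/
lemma of_mem_normalizer {Q : Subgroup G} (hQ : Q < S)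
    (ih : ∀ V : Subgroup G, Nat.card Q < Nat.card V → V ≤ S → ∀ g : G,
      (∀ x ∈ V, g⁻¹ * x * g ∈ S) → R V g)
    {T : Sylow p (Subgroup.normalizer (Q : Set G))}
    (hT : (T : Subgroup (Subgroup.normalizer (Q : Set G))) =
      (S : Subgroup G).subgroupOf (Subgroup.normalizer (Q : Set G)))
    {g : G} (hg : g ∈ Subgroup.normalizer (Q : Set G)) : R Q g := by
  let N := Subgroup.normalizer (Q : Set G)
  let K : Subgroup N :=
    { carrier := {n | R Q n}
      one_mem' := hR.one Q hQ.le
      mul_mem' {m n} hm hn :=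
        hR.mul (fun x hx => (Subgroup.mem_normalizer_iff''.mp m.2 x).mp hx) hm hn
      inv_mem' {n} hn :=
        hR.inv hQ.le (fun x hx => (Subgroup.mem_normalizer_iff''.mp n.2 x).mp hx)
          (fun x hx => (Subgroup.mem_normalizer_iff.mp n.2 x).mp hx) hn }
  by_contra hcon
  have hTS : ∀ x : N, x ∈ T ↔ (x : G) ∈ S := fun x => by
    rw [← SetLike.mem_coe, ← Sylow.coe_coe, hT]
    rfl
  have hTK : (T : Subgroup N) ≤ K := fun x hx => hR.of_mem hQ.le ((hTS x).mp hx)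
  have hQT : Q.subgroupOf N ≤ T := fun x hx => (hTS x).mpr (hQ.le hx)
  have hmem : ∀ x : N, (x : N ⧸ Q.subgroupOf N) ∈
      K.map (QuotientGroup.mk' (Q.subgroupOf N)) ↔ x ∈ K := fun x => by
    change x ∈ (K.map (QuotientGroup.mk' (Q.subgroupOf N))).comap (QuotientGroup.mk' _) ↔ _
    rw [Subgroup.comap_map_eq_self]
    rw [QuotientGroup.ker_mk']
    exact hQT.trans hTK
  have hone : ∀ x : N, (x : G) ∈ Q → (x : N ⧸ Q.subgroupOf N) = 1 := fun x hx =>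
    (QuotientGroup.eq_one_iff x).mpr hx
  have hp : p.Prime := Fact.out
  -- If `K` is proper and `K/Q` is strongly embedded, then `Q` is essential, and closure under `aut`
  -- contradicts properness.
  suffices hK : IsStronglyEmbedded p (K.map (QuotientGroup.mk' (Q.subgroupOf N))) from
    hcon (hR.aut ⟨Q, hQ.le⟩ (Or.inr ⟨⟨T, hT⟩, _, hK⟩) g hg)
  refine ⟨?_, ?_, ?_⟩
  · obtain ⟨x, hxS, hxN, hxQ⟩ := S.isPGroup'.exists_mem_normalizer_notMem hQ
    have hxT : (⟨x, hxN⟩ : N) ∈ T := (hTS _).mpr hxS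
    obtain ⟨m, hm⟩ := (T.isPGroup'.map (QuotientGroup.mk' (Q.subgroupOf N)))
      ⟨_, _, hxT, rfl⟩
    obtain ⟨j, -, hj⟩ := (Nat.dvd_prime_pow hp).mp (orderOf_dvd_of_pow_eq_one hm)
    have hj0 : j ≠ 0 := by
      rintro rfl
      rw [pow_zero, orderOf_eq_one_iff] at hj
      exact hxQ ((QuotientGroup.eq_one_iff (N := Q.subgroupOf N) (⟨x, hxN⟩ : N)).mp
        (congrArg Subtype.val hj))
    have hdvd := hj ▸ orderOf_dvd_natCard (⟨_, _, hxT, rfl⟩ :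
      (T : Subgroup N).map (QuotientGroup.mk' (Q.subgroupOf N)))
    exact ((dvd_pow_self p hj0).trans hdvd).trans
      (Subgroup.card_dvd_of_le (Subgroup.map_mono hTK))
  · intro htop
    exact hcon ((hmem ⟨g, hg⟩).mp (htop ▸ Subgroup.mem_top _))
  -- Let `z` of order `p` lie in `K/Q` and in its conjugate by `γ`, and let `Y` be the preimage of
  -- `⟨z⟩`. Elements `a`, `b` of `K` move `Y` and `γYγ⁻¹` into `S`. Then `a⁻¹γ⁻¹b` maps `a⁻¹Ya`,
  -- which is larger than `Q`, into `S`; it belongs to `R` by `ih`, which forces `γ ∈ K`.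
  · intro γ' hγ' hdvd
    obtain ⟨γ, rfl⟩ := QuotientGroup.mk_surjective γ'
    obtain ⟨⟨z, hzm⟩, hz⟩ := exists_prime_orderOf_dvd_card' p hdvd
    replace hz : orderOf z = p := by rw [← hz, Subgroup.orderOf_mk]
    obtain ⟨hzK, hzγ⟩ := Subgroup.mem_inf.mp hzm
    let Y : Subgroup N := (Subgroup.zpowers z).comap (QuotientGroup.mk' (Q.subgroupOf N))
    have hY : IsPGroup p Y := by
      refine IsPGroup.comap_of_ker_isPGroup (IsPGroup.of_card (n := 1) ?_) _ ?_
      · rw [Nat.card_zpowers, hz, pow_one]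
      · rw [QuotientGroup.ker_mk']
        exact T.isPGroup'.to_le hQT
    have hYK : Y ≤ K := fun y hy => (hmem y).mp
      ((Subgroup.zpowers_le.mpr hzK) hy)
    have hYγ : Y.map (MulAut.conj γ).toMonoidHom ≤ K := by
      have hzγ' : z ∈ (K.map (QuotientGroup.mk' (Q.subgroupOf N))).comap
          (MulAut.conj (γ : N ⧸ Q.subgroupOf N)).toMonoidHom := by
        obtain ⟨w, hwK, rfl⟩ := hzγ
        simpa [mul_assoc] using hwK
      rintro _ ⟨y, hy, rfl⟩
      exact (hmem _).mp (Subgroup.zpowers_le.mpr hzγ' hy)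
    obtain ⟨a, haK, ha⟩ := T.exists_mem_forall_inv_mul_mul_mem hTK hY hYK
    obtain ⟨b, hbK, hb⟩ := T.exists_mem_forall_inv_mul_mul_mem hTK (hY.map _) hYγ
    let Y' : Subgroup G := Y.map (N.subtype.comp (MulAut.conj a⁻¹).toMonoidHom)
    have hmemY' : ∀ y ∈ Y, (a : G)⁻¹ * y * a ∈ Y' := fun y hy => ⟨y, hy, by simp⟩
    have hQY : ∀ x (hx : x ∈ Q), (⟨x, Subgroup.le_normalizer hx⟩ : N) ∈ Y := fun x hx => by
      change ((⟨x, Subgroup.le_normalizer hx⟩ : N) : N ⧸ Q.subgroupOf N) ∈ Subgroup.zpowers z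
      rw [hone _ hx]
      exact one_mem _
    have hQY' : Q ≤ Y' := fun x hx => by
      have hx' := hmemY' _ (hQY _ ((Subgroup.mem_normalizer_iff.mp a.2 x).mp hx))
      simpa [mul_assoc] using hx'
    have hlt : Q < Y' := by
      obtain ⟨w, rfl⟩ := QuotientGroup.mk_surjective z
      refine SetLike.lt_iff_le_and_exists.mpr ⟨hQY', _, hmemY' w (Subgroup.mem_zpowers _), ?_⟩
      intro hw
      have hwQ := (Subgroup.mem_normalizer_iff''.mp a.2 w).mpr hw
      rw [hone _ hwQ, orderOf_one] at hz
      exact hp.one_lt.ne hz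
    have hRc : R Q (a⁻¹ * γ⁻¹ * b : N) := by
      refine hR.mono hQY' ?_ (ih Y' (Set.Finite.card_lt_card (Set.toFinite _) hlt) ?_ _ ?_)
      · rintro _ ⟨y, hy, rfl⟩
        have := (hTS _).mp (ha y hy)
        simpa [← SetLike.mem_coe] using this
      · rintro _ ⟨y, hy, rfl⟩
        have := (hTS _).mp (ha y hy)
        simpa [← SetLike.mem_coe] using this
      · rintro _ ⟨y, hy, rfl⟩
        have := (hTS _).mp (hb _ ⟨y, hy, rfl⟩)
        simpa [mul_assoc] using this
    have hcK : a⁻¹ * γ⁻¹ * b ∈ K := hRc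
    refine hγ' ((hmem γ).mpr ?_)
    have := K.mul_mem (K.mul_mem hbK (K.inv_mem hcK)) (K.inv_mem haK)
    simpa [mul_assoc] using this

omit hR in
/-- A subgroup `P` of `S` has a conjugate `Q ≤ S` for which `N_S(Q)` is a Sylow subgroup of
`N_G(Q)`. -/
lemma exists_conj_isSylow {P : Subgroup G} (hP : P ≤ S) :
    ∃ (Q : Subgroup G) (a : G) (T : Sylow p (Subgroup.normalizer (Q : Set G))),
      Q ≤ S ∧ (∀ x, x ∈ P ↔ a⁻¹ * x * a ∈ Q) ∧
      (T : Subgroup (Subgroup.normalizer (Q : Set G))) =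
        (S : Subgroup G).subgroupOf (Subgroup.normalizer (Q : Set G)) := by
  let N := Subgroup.normalizer (P : Set G)
  -- Conjugating a Sylow subgroup of `N_G(P)` into `S` by `a` puts a group of the same order inside
  -- `N_S(Q)`, where `Q = a⁻¹Pa`. The normal `p`-subgroup `P` lies in `T₀`, so `Q ≤ S`.
  let T₀ : Sylow p N := default
  obtain ⟨a, ha⟩ := S.exists_forall_inv_mul_mul_mem (T₀.isPGroup'.map N.subtype)
  have hT₀ : ∀ x ∈ T₀, a⁻¹ * (x : G) * a ∈ S := fun x hx => ha _ ⟨x, hx, rfl⟩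
  have hPT : ∀ x (hx : x ∈ P), (⟨x, Subgroup.le_normalizer hx⟩ : N) ∈ T₀ := by
    have : (P.subgroupOf N).Normal := Subgroup.normal_in_normalizer
    have hPN : IsPGroup p (P.subgroupOf N) :=
      (S.isPGroup'.to_le hP).comap_of_injective N.subtype
        Subtype.val_injective
    exact fun x hx => hPN.le_sylow_of_normal T₀ hx
  let Q : Subgroup G := P.comap (MulAut.conj a).toMonoidHom
  have hQ : ∀ x, x ∈ P ↔ a⁻¹ * x * a ∈ Q := by
    intro x
    change _ ↔ a * (a⁻¹ * x * a) * a⁻¹ ∈ P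
    simp [mul_assoc]
  have hQ' : ∀ x, x ∈ Q ↔ a⁻¹⁻¹ * x * a⁻¹ ∈ P := by
    intro x
    rw [inv_inv]
    rfl
  let e : N ≃ Subgroup.normalizer (Q : Set G) :=
    { toFun x := ⟨a⁻¹ * x * a, Subgroup.inv_mul_mul_mem_normalizer hQ x.2⟩
      invFun x := ⟨a⁻¹⁻¹ * x * a⁻¹, Subgroup.inv_mul_mul_mem_normalizer hQ' x.2⟩
      left_inv x := by ext; simp [mul_assoc]
      right_inv x := by ext; simp [mul_assoc] }
  have hp : IsPGroup p ((S : Subgroup G).subgroupOf (Subgroup.normalizer (Q : Set G))) :=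
    S.isPGroup'.comap_of_injective _ Subtype.val_injective
  obtain ⟨T, hT⟩ := hp.exists_sylow_eq_of_card_le (Nat.card_congr e) T₀
    (Nat.card_le_card_of_injective
      (fun x : T₀ => (⟨e x, hT₀ x x.2⟩ :
        (S : Subgroup G).subgroupOf (Subgroup.normalizer (Q : Set G))))
      fun x y hxy => Subtype.ext (e.injective (congrArg Subtype.val hxy)))
  refine ⟨Q, a, T, fun x hx => ?_, hQ, hT⟩
  have hx' : a⁻¹ * (a * x * a⁻¹) * a ∈ (S : Subgroup G) := hT₀ _ (hPT _ hx)
  simpa [mul_assoc] using hx'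

/-- Alperin's fusion theorem for transporter categories. -/
theorem of_conj_mem {P : Subgroup G} (hP : P ≤ S) {g : G} (hg : ∀ x ∈ P, g⁻¹ * x * g ∈ S) :
    R P g := by
  induction h : Nat.card S - Nat.card P using Nat.strong_induction_on generalizing P g with
  | _ n ihn =>
  rcases hP.eq_or_lt with rfl | hPS
  · exact hR.aut ⟨S, le_rfl⟩ (Or.inl rfl) g ((mem_normalizer_iff_conj_mem ⟨S, le_rfl⟩ g).mpr hg)
  have ih : ∀ V : Subgroup G, Nat.card P < Nat.card V → V ≤ S → ∀ g : G,
      (∀ x ∈ V, g⁻¹ * x * g ∈ S) → R V g := by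
    intro V hPV hV g hg
    have := Subgroup.card_le_of_le hV
    refine ihn (Nat.card S - Nat.card V) ?_ hV hg rfl
    have : Nat.card V ≤ Nat.card S := this
    omega
  -- With `h : P → Q` and `h' : g⁻¹Pg → Q` in `R`, the factorization `g = h (h⁻¹gh') h'⁻¹` reduces
  -- the claim to an automorphism of `Q`.
  obtain ⟨Q, a, T, hQ, ha, hT⟩ := exists_conj_isSylow hP
  have hcard : Nat.card P = Nat.card Q := Nat.card_congr
    { toFun x := ⟨a⁻¹ * x * a, (ha x).mp x.2⟩
      invFun x := ⟨a * x * a⁻¹, (ha _).mpr (by simp [mul_assoc])⟩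
      left_inv x := by ext; simp [mul_assoc]
      right_inv x := by ext; simp [mul_assoc] }
  let P' : Subgroup G := P.comap (MulAut.conj g).toMonoidHom
  have hP' : ∀ x, x ∈ P' ↔ g * x * g⁻¹ ∈ P := fun x => Iff.rfl
  have hgP' : ∀ x, x ∈ P ↔ g⁻¹ * x * g ∈ P' := fun x => by
    rw [hP']
    simp [mul_assoc]
  have hcard' : Nat.card P = Nat.card P' := Nat.card_congr
    { toFun x := ⟨g⁻¹ * x * g, (hgP' x).mp x.2⟩
      invFun x := ⟨g * x * g⁻¹, x.2⟩
      left_inv x := by ext; simp [mul_assoc]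
      right_inv x := by ext; simp [mul_assoc] }
  have hlt : Nat.card P < Nat.card S :=
    Set.Finite.card_lt_card (Set.toFinite _) hPS
  have hP'S : P' ≤ S := fun x hx => by
    have hx' : g⁻¹ * (g * x * g⁻¹) * g ∈ (S : Subgroup G) := hg _ ((hP' x).mp hx)
    simpa [mul_assoc] using hx'
  obtain ⟨h, hh, hRh⟩ := hR.exists_conj hPS ih ha hT
  obtain ⟨h', hh', hRh'⟩ := hR.exists_conj (P := P') (a := g⁻¹ * a)
    (hP'S.lt_of_ne fun heq => by rw [hcard', heq] at hlt; exact lt_irrefl _ hlt)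
    (by rwa [← hcard']) (fun x => by rw [hP', ha]; simp [mul_assoc]) hT
  have hn : h⁻¹ * g * h' ∈ Subgroup.normalizer (Q : Set G) := by
    rw [Subgroup.mem_normalizer_iff]
    intro y
    have h₁ := hh (g * (h' * y * h'⁻¹) * g⁻¹)
    have h₂ := hP' (h' * y * h'⁻¹)
    have h₃ := hh' (h' * y * h'⁻¹)
    simp only [mul_assoc, mul_inv_rev, inv_inv, inv_mul_cancel, inv_mul_cancel_left, mul_one]
      at h₁ h₂ h₃ ⊢
    rw [← h₃, h₂, h₁]
  have hRn := hR.of_mem_normalizer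
    (hQ.lt_of_ne fun heq => by rw [hcard, heq] at hlt; exact lt_irrefl _ hlt)
    (by rwa [← hcard]) hT hn
  have hRinv := hR.inv hQ (fun x hx => (hh' x).mp hx) (fun x hx => by
    rw [hh']
    simpa [mul_assoc] using hx) hRh'
  have hfin := hR.mul (fun x hx => (hh x).mp hx) hRh (hR.mul (fun x hx => ?_) hRn hRinv)
  · simpa [mul_assoc] using hfin
  · exact (Subgroup.mem_normalizer_iff''.mp hn x).mp hx

end IsFusionClosed

end Transporter

/-! ### The limit over the essential transporter category -/

namespace Transporter

open groupCohomology

variable {G : Type u} [Group G] {k : Type u} [CommRing k] {M : Rep.{u} k G} {n : ℕ}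

/-- The morphisms in the transporter category that fix a class in `Hⁿ(S, M)` are closed under
composition and inverses. -/
lemma isFusionClosed_of_aut {p : ℕ} {S : Subgroup G} {T : ModuleCat.{u} k}
    (x : T ⟶ groupCohomology (Rep.res S.subtype M) n)
    (haut : ∀ Q : Transporter S, essentialObjects p S Q →
      ∀ g ∈ Subgroup.normalizer (Q.sub : Set G),
        ∃ (h1 : ∀ y ∈ Q.sub, 1⁻¹ * y * 1 ∈ S) (hg : ∀ y ∈ Q.sub, g⁻¹ * y * g ∈ S),
          x ≫ conjMap M g hg n = x ≫ conjMap M 1 h1 n) :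
    IsFusionClosed p S fun P g =>
      ∃ (h1 : ∀ y ∈ P, 1⁻¹ * y * 1 ∈ S) (hg : ∀ y ∈ P, g⁻¹ * y * g ∈ S),
        x ≫ conjMap M g hg n = x ≫ conjMap M 1 h1 n where
  one P hP := ⟨fun y hy => by simpa using hP hy, fun y hy => by simpa using hP hy, rfl⟩
  mul {P Q g h} hPQ := by
    rintro ⟨h1, hg, hx⟩ ⟨h1', hh, hx'⟩
    have hgh : ∀ y ∈ P, (g * h)⁻¹ * y * (g * h) ∈ S := fun y hy => by
      simpa [mul_assoc] using hh _ (hPQ y hy)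
    refine ⟨h1, hgh, ?_⟩
    rw [← conjMap_comp_of_eq M rfl hPQ hh, ← Category.assoc, hx', Category.assoc,
      conjMap_comp_of_eq M (mul_one g).symm hPQ h1' hg, hx]
  inv {P Q g} hQ hPQ hQP := by
    rintro ⟨h1, hg, hx⟩
    have hQP' : ∀ y ∈ Q, g⁻¹⁻¹ * y * g⁻¹ ∈ P := fun y hy => by simpa using hQP y hy
    have h1' : ∀ y ∈ Q, 1⁻¹ * y * 1 ∈ S := fun y hy => by simpa using hQ hy
    have hg' : ∀ y ∈ Q, g⁻¹⁻¹ * y * g⁻¹ ∈ S := fun y hy => by simpa using h1 _ (hQP' y hy)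
    refine ⟨h1', hg', ?_⟩
    rw [← conjMap_comp_of_eq M (mul_one g⁻¹).symm hQP' h1, ← Category.assoc, ← hx,
      Category.assoc, conjMap_comp_of_eq M (inv_mul_cancel g).symm hQP' hg]
  aut := haut

/-- The object `S` of the essential transporter category. -/
abbrev Essential.top (p : ℕ) (S : Subgroup G) : Essential p S := ⟨⟨S, le_rfl⟩, Or.inl rfl⟩

/-- The inclusion of an object of the transporter category into `S`. -/
def inclusion {S : Subgroup G} (P : Transporter S) : P ⟶ ⟨S, le_rfl⟩ :=
  ⟨1, fun x hx => by simpa using P.le hx⟩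

/-- For `Q` in the essential category and `g` in `N_G(Q)`, both `1` and `g` are morphisms `Q → S`
there, so both pull the component at `S` back to the component at `Q`. The fusion theorem extends
this to all subgroups of `S`. -/
lemma isStable_limit_π [Finite G] {p : ℕ} [Fact p.Prime] (S : Sylow p G) :
    IsStable (S := (S : Subgroup G)) (M := M) (n := n)
      (limit.π (essentialCohomology M p (S : Subgroup G) n)
        (Opposite.op (Essential.top p (S : Subgroup G)))) := by
  intro P g h1 hg
  refine ((isFusionClosed_of_aut (p := p) _ fun Q hQ g hgN => ?_).of_conj_mem
    (P := P) (fun y hy => by simpa using h1 y hy) hg).2.2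
  have hg' := (mem_normalizer_iff_conj_mem Q g).mp hgN
  let i : (⟨Q, hQ⟩ : Essential p (S : Subgroup G)) ⟶ Essential.top p (S : Subgroup G) :=
    ObjectProperty.homMk (inclusion Q)
  let j : (⟨Q, hQ⟩ : Essential p (S : Subgroup G)) ⟶ Essential.top p (S : Subgroup G) :=
    ObjectProperty.homMk ⟨g, fun x hx => Q.le (hg' x hx)⟩
  exact ⟨fun y hy => by simpa using Q.le hy, fun y hy => Q.le (hg' y hy),
    (limit.w (essentialCohomology M p (S : Subgroup G) n) j.op).trans
      (limit.w (essentialCohomology M p (S : Subgroup G) n) i.op).symm⟩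

/-- The restriction maps as a cone over the cohomology functor. -/
noncomputable def restrictionCone (M : Rep.{u} k G) (p : ℕ) (S : Subgroup G) (n : ℕ) :
    Cone (essentialCohomology M p S n) where
  pt := groupCohomology M n
  π :=
    { app P := restriction M P.unop.obj n
      naturality _ _ g := (Category.id_comp _).trans
        (map_subtype_comp_conjMap M (elt g.unop.hom) (fun _ hx => elt_mem g.unop.hom hx) n).symm }

end Transporter

lemma Sylow.isUnit_index_of_isLocalization {p : ℕ} [Fact p.Prime] {G : Type*} [Group G] [Finite G]
    (S : Sylow p G) (k : Type*) [CommRing k] [IsLocalization.AtPrime k (Ideal.span {(p : ℤ)})] :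
    IsUnit ((S : Subgroup G).index : k) := by
  have h : ((S : Subgroup G).index : ℤ) ∈ (Ideal.span {(p : ℤ)}).primeCompl := by
    change ¬ _ ∈ Ideal.span {(p : ℤ)}
    rw [Ideal.mem_span_singleton, Int.natCast_dvd_natCast]
    exact S.not_dvd_index
  simpa using IsLocalization.map_units k (⟨_, h⟩ : (Ideal.span {(p : ℤ)}).primeCompl)

open Transporter in
theorem corollary3p7 {p : ℕ} [Fact p.Prime] {G : Type u} [Group G] [Finite G] (S : Sylow p G)
    {k : Type u} [CommRing k] [IsLocalization.AtPrime k (Ideal.span {(p : ℤ)})]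
    (M : Rep.{u} k G) (n : ℕ) :
    ∃ e : groupCohomology M n ≅
        limit (Transporter.essentialCohomology M p (S : Subgroup G) n),
      ∀ P : Transporter.Essential p (S : Subgroup G),
        e.hom ≫ limit.π (Transporter.essentialCohomology M p (S : Subgroup G) n) (Opposite.op P) =
          Transporter.restriction M P.obj n := by
  obtain ⟨r, hr⟩ := (S.isUnit_index_of_isLocalization k).exists_right_inv
  have := groupCohomology.mono_map_subtype (M := M) (n := n) hr
  -- Applied with the limit itself as `T`, the stable element theorem yields the inverse map.
  obtain ⟨y, hy⟩ := (isStable_limit_π (M := M) (n := n) S).exists_comp_map_subtype_eq hr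
  let F := essentialCohomology M p (S : Subgroup G) n
  let C : Cone F := restrictionCone M p (S : Subgroup G) n
  let φ : groupCohomology M n ⟶ limit F := limit.lift F C
  have hφ : ∀ P : Essential p (S : Subgroup G),
      φ ≫ limit.π F (Opposite.op P) = restriction M P.obj n :=
    fun P => limit.lift_π C (Opposite.op P)
  -- Restriction to `P` factors through `S`, where the claim is `hy`.
  have hy' : ∀ P : Essential p (S : Subgroup G),
      y ≫ restriction M P.obj n = limit.π F (Opposite.op P) := fun P => by
    let i : P ⟶ Essential.top p (S : Subgroup G) := ObjectProperty.homMk (inclusion P.obj)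
    refine Eq.trans ?_ (limit.w F i.op)
    refine (congrArg (y ≫ ·) (C.w i.op).symm).trans ((Category.assoc ..).symm.trans ?_)
    exact congrArg (· ≫ F.map i.op) hy
  refine ⟨⟨φ, y, ?_, ?_⟩, hφ⟩
  · rw [← cancel_mono (groupCohomology.map (S : Subgroup G).subtype (𝟙 _) n), Category.assoc, hy]
    exact (hφ (Essential.top p (S : Subgroup G))).trans (Category.id_comp _).symm
  · refine limit.hom_ext fun P => ?_
    refine (Category.assoc ..).trans ((congrArg (y ≫ ·) (hφ P.unop)).trans ?_)
    exact (hy' P.unop).trans (Category.id_comp _).symm
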